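/- **Setting.** There are $n$ bins; bin $i$ has a positive integer weight $N_i$, and $N=\sum_i N_i$. A probability distribution $\mathcal D$ on the bins is $(\alpha,\beta)$-biased if $\frac{N_i}{\alpha N}\le \mathcal D(i)\le \frac{\beta N_i}{N}$ for every bin $i$. In each round two bins are drawn independently, with replacement, from $\mathcal D$, and the weight of a ball is drawn from a probability distribution $\mathcal W$ on $[0,\infty)$; the draws are independent of each other and of all earlier rounds. The ball is put into that one of the two drawn bins whose current value is smaller, where the value $v_i(t)$ of bin $i$ after $t$ rounds is the total weight of the balls in bin $i$ divided by $N_i$. Ties are broken arbitrarily (possibly at random, but without knowledge of later rounds). Let $\mathrm{Gap}(t)=\max_i v_i(t)-\min_j v_j(t)$. **Theorem.** Let $0<\alpha<\sqrt{5/4}$ and $\beta<\sqrt{4/3}$, and let $\mathcal W$ be a probability distribution on $[0,\infty)$ with mean $1$ such that $\mathbb E_{w\sim\mathcal W}[e^{\lambda w}]<\infty$ for some $\lambda>0$. Then there are constants $a\in(0,1)$ and $\tilde c>0$ that depend only on $\mathcal W$, $\alpha$ and $\beta$ such that, for all bins with positive integer weights of total weight $N$, every $(\alpha,\beta)$-biased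 distribution $\mathcal D$ on them, every real $k>0$ and every time $t\ge 0$, $$\Pr\left[\mathrm{Gap}(t)\ \ge\ \frac{2k}{a}\,\log\left(\frac{\tilde c}{a^{1/k}}\,N\right)\right]\ \le\ N^{-(k-1)} .$$ -/

import Mathlib

open MeasureTheory ProbabilityTheory

/-- The total weight `N = ∑ i, N_i` of the bins. -/
def totalWeight {n : ℕ} (b : Fin n → ℕ) : ℕ := ∑ i, b i

/-- A distribution `D` on the bins is `(α, β)`-biased with respect to the bin weights `b`:
`N_i / (α N) ≤ D(i) ≤ β N_i / N` for every bin `i`. -/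
def IsBiased {n : ℕ} (α β : ℝ) (b : Fin n → ℕ) (D : Measure (Fin n)) : Prop :=
  ∀ i, (b i : ℝ) / (α * totalWeight b) ≤ D.real {i} ∧
    D.real {i} ≤ β * b i / totalWeight b

/-- The total weight of the balls in bin `i` after the first `t` rounds, when the ball of round
`s + 1` has weight `w s` and is put into bin `c s`. -/
noncomputable def binLoad {Ω : Type*} {n : ℕ} (c : ℕ → Ω → Fin n) (w : ℕ → Ω → ℝ)
    (t : ℕ) (i : Fin n) (ω : Ω) : ℝ :=
  ∑ s ∈ Finset.range t, if c s ω = i then w s ω else 0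

/-- The value `v_i(t) = w_i(t) / N_i` of bin `i` after the first `t` rounds. -/
noncomputable def binValue {Ω : Type*} {n : ℕ} (b : Fin n → ℕ) (c : ℕ → Ω → Fin n)
    (w : ℕ → Ω → ℝ) (t : ℕ) (i : Fin n) (ω : Ω) : ℝ :=
  binLoad c w t i ω / b i

/-- `Gap(t) = max_i v_i(t) - min_j v_j(t)`. -/
noncomputable def binGap {Ω : Type*} {n : ℕ} (b : Fin n → ℕ) (c : ℕ → Ω → Fin n)
    (w : ℕ → Ω → ℝ) (t : ℕ) (ω : Ω) : ℝ :=
  (⨆ i, binValue b c w t i ω) - ⨅ j, binValue b c w t j ω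

/-- The two-choice process. In round `s + 1` the bins `x s` and `y s` are drawn from `D` and the
ball weight `w s` from `W`, independently of each other and of everything that happened in the
earlier rounds, and the ball is put into that one, `c s`, of the two drawn bins whose value after
the earlier rounds is the smaller. Ties are broken arbitrarily (possibly at random, but without
knowledge of later rounds). -/
structure IsTwoChoiceProcess {Ω : Type*} [MeasurableSpace Ω] (μ : Measure Ω) {n : ℕ}
    (b : Fin n → ℕ) (D : Measure (Fin n)) (W : Measure ℝ)
    (x y c : ℕ → Ω → Fin n) (w : ℕ → Ω → ℝ) : Prop where
  measurable_x : ∀ s, Measurable (x s)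
  measurable_y : ∀ s, Measurable (y s)
  measurable_c : ∀ s, Measurable (c s)
  measurable_w : ∀ s, Measurable (w s)
  /-- the joint law of the three draws of a round -/
  law : ∀ s, μ.map (fun ω => (x s ω, y s ω, w s ω)) = D.prod (D.prod W)
  /-- the draws of a round are independent of all earlier draws and choices -/
  indep : ∀ s, IndepFun (fun ω => (x s ω, y s ω, w s ω))
    (fun ω => fun r : Fin s => (x r ω, y r ω, w r ω, c r ω)) μ
  choice_mem : ∀ s ω, c s ω = x s ω ∨ c s ω = y s ω
  choice_le : ∀ s ω, binValue b c w s (c s ω) ω ≤ binValue b c w s (x s ω) ω ∧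
    binValue b c w s (c s ω) ω ≤ binValue b c w s (y s ω) ω

/-! Let `z i` be `a` times the deviation of the value of bin `i` from the average value, and let `G
= ∑ i, b i * cosh (z i)`. The expectation of `G` stays at most `2N` at all times. A gap `g` forces
`G ≥ exp (a * g / 2) / 2`, so Markov's inequality gives a tail bound that does not depend on time.

The bound on `E G` comes from a drift inequality: in expectation one round changes `G` by at most
`-(aδ/8) G/N + aδ/4`. The first-order term is `a` times the mean of the smaller of two `D`-samples
of `sinh z`, minus the mean of `sinh z` under `q i = b i / N`. On each superlevel set `A`, bias
gives `q(A) - D(A)² ≥ δ q(A)(1 - q(A))` (`sq_le_sub_of_biased`). Integrating over levels, the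
decrease is at least `δ` times that of two unbiased samples (`sum_min_gap`), namely `δ/2` times
their mean distance. Since `z` has `q`-mean zero, this distance is at least half the mean of `|sinh
z| ≥ cosh z - 1` (`half_abs_sinh_le_sum`). The second-order error is `O(a²) G/N`, so a small `a`
makes it at most half of the gain. -/

/-! ### Convexity of `sinh` and distances from mean-zero distributions -/

theorem Real.mul_sinh_le_mul_sinh {x y : ℝ} (hy : 0 ≤ y) (hyx : y ≤ x) :
    x * Real.sinh y ≤ y * Real.sinh x := by
  have hconv : ConvexOn ℝ (Set.Ici (0 : ℝ)) Real.sinh := by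
    refine convexOn_of_deriv2_nonneg (convex_Ici 0) Real.continuous_sinh.continuousOn
      Real.differentiable_sinh.differentiableOn ?_ ?_
    · rw [Real.deriv_sinh]
      exact Real.differentiable_cosh.differentiableOn
    · intro x hx
      rw [interior_Ici] at hx
      simp only [Function.iterate_succ, Function.iterate_zero, Function.comp, id,
        Real.deriv_sinh, Real.deriv_cosh]
      exact Real.sinh_nonneg_iff.2 (le_of_lt hx)
  rcases hy.eq_or_lt with rfl | hy
  · simp
  have hx : 0 < x := hy.trans_le hyx
  have h := hconv.2 (Set.mem_Ici.2 (le_refl (0 : ℝ))) (Set.mem_Ici.2 hx.le)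
    (show 0 ≤ 1 - y / x by rw [sub_nonneg, div_le_one hx]; exact hyx)
    (show 0 ≤ y / x by positivity) (by ring)
  simp only [smul_eq_mul, mul_zero, Real.sinh_zero, zero_add] at h
  rw [div_mul_cancel₀ _ hx.ne'] at h
  calc x * Real.sinh y ≤ x * (y / x * Real.sinh x) := by gcongr
    _ = y * Real.sinh x := by field_simp

/-- For `0 ≤ y ≤ x` the chord from the origin gives this even without the factor 2. The factor pays
for negative `y`: if `-x ≤ y` then `x - y ≤ 2 * x`, and beyond `-x` the chord bound applies to `-y`.
-/
theorem Real.sinh_mul_sub_le {x : ℝ} (hx : 0 < x) (y : ℝ) :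
    Real.sinh x * (x - y) ≤ 2 * x * |Real.sinh x - Real.sinh y| := by
  have hs : 0 < Real.sinh x := Real.sinh_pos_iff.2 hx
  rcases le_total x y with h | h
  · have : Real.sinh x * (x - y) ≤ 0 := mul_nonpos_of_nonneg_of_nonpos hs.le (by linarith)
    exact this.trans (by positivity)
  have h1 : Real.sinh y ≤ Real.sinh x := Real.sinh_le_sinh.2 h
  rw [abs_of_nonneg (by linarith)]
  rcases le_total 0 y with h0 | h0
  · have := Real.mul_sinh_le_mul_sinh h0 h
    nlinarith
  · rcases le_total (-y) x with h2 | h2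
    · have : Real.sinh y ≤ 0 := Real.sinh_nonpos_iff.2 h0
      nlinarith
    · have := Real.mul_sinh_le_mul_sinh hx.le h2
      rw [Real.sinh_neg] at this
      nlinarith [Real.sinh_nonpos_iff.2 h0]

/-- The lower bound is affine in `y`, so averaging over a mean-zero distribution removes the `κ`
term. -/
theorem Real.exists_half_abs_sinh_sub_le (x : ℝ) :
    ∃ κ : ℝ, ∀ y, |Real.sinh x| / 2 - κ * y ≤ |Real.sinh x - Real.sinh y| := by
  have pos : ∀ x : ℝ, 0 < x → ∀ y,
      |Real.sinh x| / 2 - Real.sinh x / (2 * x) * y ≤ |Real.sinh x - Real.sinh y| := by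
    intro x hx y
    rw [abs_of_pos (Real.sinh_pos_iff.2 hx)]
    have h := Real.sinh_mul_sub_le hx y
    have e : Real.sinh x / 2 - Real.sinh x / (2 * x) * y = Real.sinh x * (x - y) / (2 * x) := by
      field_simp
    rw [e, div_le_iff₀ (by positivity)]
    linarith
  rcases lt_trichotomy x 0 with hx | rfl | hx
  · refine ⟨-(Real.sinh (-x) / (2 * -x)), fun y => ?_⟩
    have h := pos (-x) (by linarith) (-y)
    simp only [Real.sinh_neg, abs_neg] at h
    rw [show -Real.sinh x - -Real.sinh y = -(Real.sinh x - Real.sinh y) by ring, abs_neg] at h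
    refine le_trans (le_of_eq ?_) h
    rw [Real.sinh_neg]; ring
  · exact ⟨0, fun y => by simp⟩
  · exact ⟨_, pos x hx⟩

/-- A distribution with mean zero has average distance at least `|sinh x| / 2` to `x`, measured
through `sinh`. -/
theorem half_abs_sinh_le_sum {ι : Type*} [Fintype ι] {q z : ι → ℝ} (hq : ∀ i, 0 ≤ q i)
    (hq1 : ∑ i, q i = 1) (hz : ∑ i, q i * z i = 0) (x : ℝ) :
    |Real.sinh x| / 2 ≤ ∑ i, q i * |Real.sinh x - Real.sinh (z i)| := by
  obtain ⟨κ, hκ⟩ := Real.exists_half_abs_sinh_sub_le x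
  calc |Real.sinh x| / 2 = ∑ i, q i * (|Real.sinh x| / 2 - κ * z i) := by
        simp_rw [mul_sub, Finset.sum_sub_distrib, ← Finset.sum_mul, hq1, mul_left_comm _ κ,
          ← Finset.mul_sum, hz]
        ring
    _ ≤ _ := Finset.sum_le_sum fun i _ => mul_le_mul_of_nonneg_left (hκ _) (hq i)

/-! ### Comparing biased and unbiased two-choice sampling -/

/-- Layer-cake principle: an inequality between weighted sums of the values `h k` follows from the
corresponding inequalities between the weights of all the sets `{k | s < h k}`. -/
theorem sum_mul_nonneg_of_layers {κ : Type*} [Fintype κ] (c h : κ → ℝ) (hc : ∑ k, c k = 0)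
    (hs : ∀ s : ℝ, 0 ≤ ∑ k, c k * (if s < h k then 1 else 0)) : 0 ≤ ∑ k, c k * h k := by
  set B : ℝ := ∑ k, |h k|
  have hB : ∀ k, |h k| ≤ B := fun k =>
    Finset.single_le_sum (f := fun k => |h k|) (fun k _ => abs_nonneg _) (Finset.mem_univ k)
  have hB0 : 0 ≤ B := Finset.sum_nonneg fun k _ => abs_nonneg _
  have hint : ∀ k, IntervalIntegrable (fun s : ℝ => if s < h k then (1 : ℝ) else 0) volume
      (-B) B := by
    intro k
    refine AntitoneOn.intervalIntegrable fun s _ t _ hst => ?_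
    split_ifs with h1 h2 <;> first | exact absurd (hst.trans_lt h1) h2 | norm_num
  -- The extra `B` is the same for all `k`, so it cancels because the coefficients sum to zero.
  have hval : ∀ k, ∫ s in (-B)..B, (if s < h k then (1 : ℝ) else 0) = h k + B := by
    intro k
    have h1 := (abs_le.1 (hB k)).1
    have h2 := (abs_le.1 (hB k)).2
    have e1 : ∫ s in (-B)..(h k), (if s < h k then (1 : ℝ) else 0) = ∫ s in (-B)..(h k), 1 := by
      refine intervalIntegral.integral_congr_ae ?_
      filter_upwards [compl_mem_ae_iff.2 (measure_singleton (μ := volume) (h k))] with s hs1 hs2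
      rw [Set.uIoc_of_le h1] at hs2
      exact if_pos (lt_of_le_of_ne hs2.2 hs1)
    have e2 : ∫ s in (h k)..B, (if s < h k then (1 : ℝ) else 0) = ∫ s in (h k)..B, 0 := by
      refine intervalIntegral.integral_congr fun s hs1 => ?_
      rw [Set.uIcc_of_le h2] at hs1
      exact if_neg (not_lt.2 hs1.1)
    rw [← intervalIntegral.integral_add_adjacent_intervals (b := h k)
      ((hint k).mono_set ?_) ((hint k).mono_set ?_), e1, e2]
    · simp
    · rw [Set.uIcc_of_le h1, Set.uIcc_of_le (h1.trans h2)]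
      exact Set.Icc_subset_Icc le_rfl h2
    · rw [Set.uIcc_of_le h2, Set.uIcc_of_le (h1.trans h2)]
      exact Set.Icc_subset_Icc h1 le_rfl
  have key : 0 ≤ ∫ s in (-B)..B, ∑ k, c k * (if s < h k then (1 : ℝ) else 0) :=
    intervalIntegral.integral_nonneg (by linarith) fun s _ => hs s
  rw [intervalIntegral.integral_finsetSum fun k _ => (hint k).const_mul _] at key
  simp_rw [intervalIntegral.integral_const_mul, hval, mul_add, Finset.sum_add_distrib,
    ← Finset.sum_mul, hc, zero_mul, add_zero] at key
  exact key

/-- A minimum exceeds `s` exactly when both entries lie in `A = {g > s}`, so `hA` for superlevel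
sets is the claim at level `s`. Single-sample means become diagonal terms of a sum over pairs, as
`min (g i) (g i) = g i`. -/
theorem sum_min_gap {ι : Type*} [Fintype ι] {q d : ι → ℝ} {δ : ℝ}
    (hq1 : ∑ i, q i = 1) (hd1 : ∑ i, d i = 1)
    (hA : ∀ A : Finset ι, δ * ((∑ i ∈ A, q i) * (1 - ∑ i ∈ A, q i)) ≤
      ∑ i ∈ A, q i - (∑ i ∈ A, d i) ^ 2) (g : ι → ℝ) :
    δ * (∑ i, q i * g i - ∑ i, ∑ j, q i * q j * min (g i) (g j)) ≤
      ∑ i, q i * g i - ∑ i, ∑ j, d i * d j * min (g i) (g j) := by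
  classical
  have expand : ∀ f : ι → ι → ℝ,
      ∑ k : ι × ι, ((if k.1 = k.2 then (1 - δ) * q k.1 else 0) - d k.1 * d k.2 +
        δ * (q k.1 * q k.2)) * f k.1 k.2 =
      (1 - δ) * ∑ i, q i * f i i - ∑ i, ∑ j, d i * d j * f i j +
        δ * ∑ i, ∑ j, q i * q j * f i j := by
    intro f
    simp_rw [Fintype.sum_prod_type, add_mul, sub_mul, Finset.sum_add_distrib,
      Finset.sum_sub_distrib, ite_mul, zero_mul, Finset.sum_ite_eq, Finset.mem_univ, if_true,
      mul_assoc, ← Finset.mul_sum]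
    simp_rw [sub_mul, Finset.sum_sub_distrib, one_mul, mul_assoc, Finset.mul_sum]
  have h := sum_mul_nonneg_of_layers
    (fun k : ι × ι => (if k.1 = k.2 then (1 - δ) * q k.1 else 0) - d k.1 * d k.2 +
        δ * (q k.1 * q k.2)) (fun k => min (g k.1) (g k.2)) ?_ ?_
  · rw [expand fun i j => min (g i) (g j)] at h
    simp only [min_self] at h
    linarith
  · have := expand fun _ _ => 1
    simp only [mul_one] at this
    rw [this]
    simp_rw [← Finset.mul_sum, ← Finset.sum_mul, hq1, hd1]
    ring
  · intro s
    rw [expand fun i j => if s < min (g i) (g j) then 1 else 0]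
    have hsq : ∀ p : ι → ℝ, ∑ i, ∑ j, p i * p j * (if s < min (g i) (g j) then (1 : ℝ) else 0) =
        (∑ i ∈ Finset.univ.filter (fun i => s < g i), p i) ^ 2 := by
      intro p
      rw [sq, Finset.sum_filter, Finset.sum_mul_sum]
      refine Finset.sum_congr rfl fun i _ => Finset.sum_congr rfl fun j _ => ?_
      by_cases h1 : s < g i <;> by_cases h2 : s < g j <;> simp [h1, h2]
    have hA' := hA (Finset.univ.filter fun i => s < g i)
    rw [hsq, hsq]
    simp only [min_self, mul_ite, mul_one, mul_zero]
    rw [← Finset.sum_filter]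
    linarith

/-- The drift of the `sinh` profile under the choice of the smaller of two samples. -/
theorem sinh_min_drift {ι : Type*} [Fintype ι] {q d z : ι → ℝ} {δ : ℝ} (hδ : 0 ≤ δ)
    (hq : ∀ i, 0 ≤ q i) (hq1 : ∑ i, q i = 1) (hd1 : ∑ i, d i = 1) (hz : ∑ i, q i * z i = 0)
    (hA : ∀ A : Finset ι, δ * ((∑ i ∈ A, q i) * (1 - ∑ i ∈ A, q i)) ≤
      ∑ i ∈ A, q i - (∑ i ∈ A, d i) ^ 2) :
    δ / 4 * (∑ i, q i * Real.cosh (z i) - 1) ≤ ∑ i, q i * Real.sinh (z i) -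
      ∑ i, ∑ j, d i * d j * min (Real.sinh (z i)) (Real.sinh (z j)) := by
  refine le_trans ?_ (sum_min_gap hq1 hd1 hA fun i => Real.sinh (z i))
  -- Both samples have law `q`, so mean minus mean minimum is half the mean distance.
  have h1 : ∑ i, q i * Real.sinh (z i) -
      ∑ i, ∑ j, q i * q j * min (Real.sinh (z i)) (Real.sinh (z j)) =
      ∑ i, q i * ((∑ j, q j * |Real.sinh (z i) - Real.sinh (z j)|) / 2) := by
    have hmin : ∀ u v : ℝ, min u v = (u + v) / 2 - |u - v| / 2 := by
      intro u v
      rcases le_total u v with h | h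
      · rw [min_eq_left h, abs_of_nonpos (by linarith)]; ring
      · rw [min_eq_right h, abs_of_nonneg (by linarith)]; ring
    have h2 : ∀ i, ∑ j, q i * q j * min (Real.sinh (z i)) (Real.sinh (z j)) =
        q i * Real.sinh (z i) / 2 + q i * (∑ j, q j * Real.sinh (z j)) / 2 -
        q i * ((∑ j, q j * |Real.sinh (z i) - Real.sinh (z j)|) / 2) := by
      intro i
      calc _ = ∑ j, (q i * Real.sinh (z i) / 2 * q j + q i / 2 * (q j * Real.sinh (z j)) -
            q i / 2 * (q j * |Real.sinh (z i) - Real.sinh (z j)|)) :=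
            Finset.sum_congr rfl fun j _ => by rw [hmin]; ring
        _ = _ := by
            rw [Finset.sum_sub_distrib, Finset.sum_add_distrib, ← Finset.mul_sum,
              ← Finset.mul_sum, ← Finset.mul_sum, hq1]
            ring
    simp_rw [h2, Finset.sum_sub_distrib, Finset.sum_add_distrib, ← Finset.sum_div,
      ← Finset.sum_mul, hq1]
    ring
  rw [h1, div_mul_eq_mul_div, mul_div_assoc]
  refine mul_le_mul_of_nonneg_left ?_ hδ
  calc (∑ i, q i * Real.cosh (z i) - 1) / 4 = ∑ i, q i * ((Real.cosh (z i) - 1) / 4) := by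
        simp_rw [mul_div_assoc', ← Finset.sum_div, mul_sub, Finset.sum_sub_distrib, mul_one, hq1]
    _ ≤ _ := Finset.sum_le_sum fun i _ => mul_le_mul_of_nonneg_left ?_ (hq i)
  have h3 := half_abs_sinh_le_sum hq hq1 hz (z i)
  -- `cosh z - |sinh z| = exp (-|z|) ≤ 1`.
  have h4 : Real.cosh (z i) - 1 ≤ |Real.sinh (z i)| := by
    refine le_abs.2 ?_
    have e1 := Real.cosh_sub_sinh (z i)
    have e2 := Real.cosh_add_sinh (z i)
    rcases le_total 0 (z i) with h | h
    · left
      have := Real.exp_le_one_iff.2 (neg_nonpos.2 h)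
      linarith
    · right
      have := Real.exp_le_one_iff.2 h
      linarith
  linarith

/-! ### The bias condition on sets -/

/-- For `Q ≤ 3/4` the upper bias bound gives `F² ≤ (3/4) β² Q`, which is where `β² < 4/3` enters.
For larger `Q` the lower bias bound on the complement keeps `F` away from 1. -/
theorem sq_le_sub_of_biased {α β Q F : ℝ} (hα_pos : 0 < α) (hα : α < Real.sqrt (5 / 4))
    (hβ : β ^ 2 < 4 / 3) (hQ0 : 0 ≤ Q) (hQ1 : Q ≤ 1) (hF0 : 0 ≤ F) (hFβ : F ≤ β * Q)
    (hFα : (1 - Q) / α ≤ 1 - F) :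
    min (1 - 3 / 4 * β ^ 2) (1 / 2) * (Q * (1 - Q)) ≤ Q - F ^ 2 := by
  set δ := min (1 - 3 / 4 * β ^ 2) (1 / 2) with hδ
  have hδ1 : δ ≤ 1 - 3 / 4 * β ^ 2 := min_le_left _ _
  have hδ2 : δ ≤ 1 / 2 := min_le_right _ _
  have hr : 0 ≤ Q * (1 - Q) := mul_nonneg hQ0 (by linarith)
  rcases le_total Q (3 / 4) with h | h
  · have h1 : F ^ 2 ≤ β ^ 2 * Q ^ 2 := by
      rw [← mul_pow]; exact pow_le_pow_left₀ hF0 hFβ 2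
    have h2 : δ * (Q * (1 - Q)) ≤ (1 - 3 / 4 * β ^ 2) * Q :=
      (mul_le_mul_of_nonneg_right hδ1 hr).trans
        (mul_le_mul_of_nonneg_left (by nlinarith) (by linarith))
    have h3 : 0 ≤ β ^ 2 * (Q * (3 / 4 - Q)) :=
      mul_nonneg (sq_nonneg _) (mul_nonneg hQ0 (by linarith))
    linarith
  · have h1 : α ^ 2 < 5 / 4 := by
      rw [← Real.sq_sqrt (show (0 : ℝ) ≤ 5 / 4 by norm_num)]
      exact pow_lt_pow_left₀ hα hα_pos.le two_ne_zero
    -- A rational bound suffices: `(9/8)² = 81/64 > 5/4`.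
    have h2 : α < 9 / 8 := by nlinarith
    have h3 : 8 / 9 * (1 - Q) ≤ (1 - Q) / α := by
      rw [le_div_iff₀ hα_pos]
      nlinarith
    have h4 : F ≤ 1 - 8 / 9 * (1 - Q) := by linarith
    have h5 : F ^ 2 ≤ (1 - 8 / 9 * (1 - Q)) ^ 2 := pow_le_pow_left₀ hF0 h4 2
    have h6 : δ * (Q * (1 - Q)) ≤ 1 / 2 * (Q * (1 - Q)) := mul_le_mul_of_nonneg_right hδ2 hr
    nlinarith

/-! ### The potential and its one-round drift -/

theorem Real.cosh_add_le (z h : ℝ) :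
    Real.cosh (z + h) ≤
      Real.cosh z + h * Real.sinh z + h ^ 2 * Real.exp |h| * Real.cosh z := by
  have bound : ∀ h : ℝ, Real.exp h - 1 - h ≤ h ^ 2 * Real.exp |h| := by
    intro h
    have := Complex.norm_exp_sub_sum_le_norm_mul_exp h 2
    simp only [Finset.sum_range_succ, Finset.sum_range_zero, pow_zero, pow_one, Nat.factorial,
      Nat.cast_one, div_one, zero_add, mul_one, Complex.norm_real, Real.norm_eq_abs,
      sq_abs] at this
    refine le_trans (le_abs_self _) ?_
    have e : (Complex.exp h - (1 + (h : ℂ))) = ((Real.exp h - 1 - h : ℝ) : ℂ) := by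
      push_cast; ring
    rw [e, Complex.norm_real, Real.norm_eq_abs] at this
    exact this
  have h1 := bound h
  have h2 := bound (-h)
  rw [abs_neg, neg_sq] at h2
  rw [Real.cosh_eq, Real.sinh_eq, Real.cosh_eq, neg_add, Real.exp_add, Real.exp_add]
  nlinarith [mul_le_mul_of_nonneg_left h1 (Real.exp_pos z).le,
    mul_le_mul_of_nonneg_left h2 (Real.exp_pos (-z)).le]

/-- The deviation of the value of bin `i` from the average value, scaled by `a`. -/
noncomputable def binDeviation {Ω : Type*} {n : ℕ} (a : ℝ) (b : Fin n → ℕ) (c : ℕ → Ω → Fin n)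
    (w : ℕ → Ω → ℝ) (t : ℕ) (i : Fin n) (ω : Ω) : ℝ :=
  a * (binValue b c w t i ω - (∑ s ∈ Finset.range t, w s ω) / totalWeight b)

/-- The hyperbolic cosine potential of a vector of deviations. -/
noncomputable def coshPotential {n : ℕ} (b : Fin n → ℕ) (z : Fin n → ℝ) : ℝ :=
  ∑ i, b i * Real.cosh (z i)

section Deterministic

variable {n : ℕ} {b : Fin n → ℕ}

theorem coshPotential_nonneg (z : Fin n → ℝ) : 0 ≤ coshPotential b z :=
  Finset.sum_nonneg fun _ _ => mul_nonneg (Nat.cast_nonneg _) (Real.cosh_pos _).le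

theorem cosh_le_coshPotential (hb : ∀ i, 0 < b i) (z : Fin n → ℝ) (i : Fin n) :
    Real.cosh (z i) ≤ coshPotential b z := by
  have h1 : (1 : ℝ) ≤ b i := by exact_mod_cast hb i
  calc Real.cosh (z i) ≤ b i * Real.cosh (z i) := le_mul_of_one_le_left (Real.cosh_pos _).le h1
    _ ≤ _ := Finset.single_le_sum (f := fun i => (b i : ℝ) * Real.cosh (z i))
        (fun _ _ => mul_nonneg (Nat.cast_nonneg _) (Real.cosh_pos _).le) (Finset.mem_univ i)

theorem cast_totalWeight : (totalWeight b : ℝ) = ∑ i, (b i : ℝ) := by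
  simp [totalWeight]

theorem le_totalWeight (i : Fin n) : (b i : ℝ) ≤ totalWeight b := by
  rw [cast_totalWeight]
  exact Finset.single_le_sum (f := fun i => (b i : ℝ)) (fun _ _ => Nat.cast_nonneg _)
    (Finset.mem_univ i)

theorem binDeviation_zero {Ω : Type*} (a : ℝ) (c : ℕ → Ω → Fin n) (w : ℕ → Ω → ℝ) (i : Fin n)
    (ω : Ω) : binDeviation a b c w 0 i ω = 0 := by
  simp [binDeviation, binValue, binLoad]

theorem binDeviation_succ {Ω : Type*} (a : ℝ) (c : ℕ → Ω → Fin n) (w : ℕ → Ω → ℝ) (t : ℕ)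
    (i : Fin n) (ω : Ω) : binDeviation a b c w (t + 1) i ω = binDeviation a b c w t i ω +
      a * ((if c t ω = i then w t ω else 0) / b i - w t ω / totalWeight b) := by
  simp only [binDeviation, binValue, binLoad, Finset.sum_range_succ]
  ring

theorem sum_mul_binDeviation {Ω : Type*} (hb : ∀ i, 0 < b i) (a : ℝ) (c : ℕ → Ω → Fin n)
    (w : ℕ → Ω → ℝ) (t : ℕ) (ω : Ω) : ∑ i, b i * binDeviation a b c w t i ω = 0 := by
  rcases isEmpty_or_nonempty (Fin n) with h | ⟨⟨i₀⟩⟩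
  · simp
  have hN : (totalWeight b : ℝ) ≠ 0 :=
    ((Nat.cast_pos.2 (hb i₀)).trans_le (le_totalWeight i₀)).ne'
  induction t with
  | zero => simp [binDeviation_zero]
  | succ t ih =>
    simp_rw [binDeviation_succ, mul_add, Finset.sum_add_distrib, ih, zero_add]
    have : ∀ i, (b i : ℝ) * (a * ((if c t ω = i then w t ω else 0) / b i -
        w t ω / totalWeight b)) = a * (if c t ω = i then w t ω else 0) -
        b i * (a * w t ω / totalWeight b) := by
      intro i
      have : (b i : ℝ) ≠ 0 := by exact_mod_cast (hb i).ne'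
      field_simp
    simp_rw [this, Finset.sum_sub_distrib, ← Finset.mul_sum, ← Finset.sum_mul, ← cast_totalWeight]
    simp
    field_simp
    simp

/-- Second-order expansion in every bin. The chosen bin contributes `cosh (z c)` to the error, and
the common shift by `w / N` only the average `G / N`; integer weights keep the displacement per unit
of `w` at most 1. -/
theorem coshPotential_step (hb : ∀ i, 0 < b i) {a l : ℝ} (ha : 0 ≤ a) (hal : a ≤ l)
    (z : Fin n → ℝ) (c : Fin n) (w : ℝ) :
    coshPotential b (fun i => z i + a * ((if c = i then w else 0) / b i - w / totalWeight b)) ≤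
      coshPotential b z +
      w * (a * (Real.sinh (z c) - ∑ i, b i / totalWeight b * Real.sinh (z i))) +
      w ^ 2 * Real.exp (l * |w|) *
        (a ^ 2 * (Real.cosh (z c) + coshPotential b z / totalWeight b)) := by
  set N : ℝ := (totalWeight b : ℝ) with hN
  have hb1 : ∀ i, (1 : ℝ) ≤ b i := fun i => by exact_mod_cast hb i
  have hbN : ∀ i, (b i : ℝ) ≤ N := le_totalWeight
  have hN1 : 1 ≤ N := (hb1 c).trans (hbN c)
  have hN0 : 0 < N := by linarith
  have term : ∀ i, b i * Real.cosh (z i + a * ((if c = i then w else 0) / b i - w / N)) ≤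
      b i * Real.cosh (z i) +
      w * a * ((if c = i then 1 else 0) * Real.sinh (z i) - b i / N * Real.sinh (z i)) +
      w ^ 2 * Real.exp (l * |w|) * a ^ 2 *
        ((if c = i then 1 else 0) * Real.cosh (z i) + b i * Real.cosh (z i) / N) := by
    intro i
    have hbi : 0 < (b i : ℝ) := by linarith [hb1 i]
    have hib : 1 / (b i : ℝ) ≤ 1 := by rw [div_le_one hbi]; exact hb1 i
    have hiN : 1 / N ≤ 1 / b i := one_div_le_one_div_of_le hbi (hbN i)
    have hiN0 : 0 < 1 / N := by positivity
    obtain ⟨r, hr, hr1, hr2⟩ : ∃ r : ℝ, (if c = i then w else 0) / b i - w / N = w * r ∧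
        |r| ≤ 1 ∧ b i * r ^ 2 ≤ (if c = i then 1 else 0) + b i / N := by
      split_ifs with h
      · refine ⟨1 / b i - 1 / N, by ring, ?_, ?_⟩
        · rw [abs_of_nonneg (by linarith)]; linarith
        · have h1 : (1 / b i - 1 / N) ^ 2 ≤ (1 / b i) * (1 / (b i : ℝ)) := by nlinarith
          have h2 : b i * (1 / b i - 1 / N) ^ 2 ≤ b i * ((1 / b i) * (1 / (b i : ℝ))) :=
            mul_le_mul_of_nonneg_left h1 hbi.le
          have h3 : b i * ((1 / b i) * (1 / (b i : ℝ))) = 1 / b i := by field_simp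
          have h4 : 0 ≤ b i / N := by positivity
          linarith
      · refine ⟨-(1 / N), by ring, ?_, ?_⟩
        · rw [abs_neg, abs_of_pos hiN0]; linarith
        · rw [neg_sq, zero_add, sq, div_eq_mul_one_div (b i : ℝ) N]
          refine mul_le_mul_of_nonneg_left ?_ hbi.le
          nlinarith
    have hfirst : b i * (a * (w * r)) =
        w * a * ((if c = i then 1 else 0) - b i / N) := by
      rw [← hr]
      split_ifs
      · field_simp
      · field_simp
        ring
    have h1 := mul_le_mul_of_nonneg_left (Real.cosh_add_le (z i) (a * (w * r))) hbi.le
    have hexp : Real.exp |a * (w * r)| ≤ Real.exp (l * |w|) := by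
      rw [Real.exp_le_exp, abs_mul, abs_mul, abs_of_nonneg ha]
      have hl : 0 ≤ l := ha.trans hal
      calc a * (|w| * |r|) ≤ l * (|w| * 1) := by gcongr
        _ = _ := by ring
    have h2 : b i * ((a * (w * r)) ^ 2 * Real.exp |a * (w * r)| * Real.cosh (z i)) ≤
        w ^ 2 * Real.exp (l * |w|) * a ^ 2 *
          (((if c = i then 1 else 0) + b i / N) * Real.cosh (z i)) := by
      have hc := (Real.cosh_pos (z i)).le
      calc _ = (b i * r ^ 2) * (w ^ 2 * a ^ 2 * Real.exp |a * (w * r)| * Real.cosh (z i)) := by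
            ring
        _ ≤ ((if c = i then 1 else 0) + b i / N) *
            (w ^ 2 * a ^ 2 * Real.exp (l * |w|) * Real.cosh (z i)) := by
            have : 0 ≤ (if c = i then 1 else 0) + b i / N :=
              (mul_nonneg hbi.le (sq_nonneg r)).trans hr2
            gcongr
        _ = _ := by ring
    rw [hr]
    calc _ ≤ _ := h1
      _ = b i * Real.cosh (z i) + (b i * (a * (w * r))) * Real.sinh (z i) +
          b i * ((a * (w * r)) ^ 2 * Real.exp |a * (w * r)| * Real.cosh (z i)) := by ring
      _ ≤ _ := add_le_add_right h2 _
      _ = _ := by rw [hfirst]; ring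
  refine (Finset.sum_le_sum fun i _ => term i).trans (le_of_eq ?_)
  simp_rw [Finset.sum_add_distrib, ← Finset.mul_sum, Finset.sum_sub_distrib,
    Finset.sum_add_distrib, ite_mul, one_mul, zero_mul, Finset.sum_ite_eq, Finset.mem_univ,
    if_true, ← Finset.sum_div, coshPotential]
  ring

/-- The double sums are expectations over the two draws, with `w` replaced by its mean 1 and the
error moment by `S`. The first-order gain is `(aδ/4)(G/N - 1)`; the error is at most `S a² (2β + 1)
G/N`, and `haS` makes this at most `(aδ/8) G/N`. -/
theorem coshPotential_drift {α β a S : ℝ} {d z : Fin n → ℝ} (hb : ∀ i, 0 < b i)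
    (hα_pos : 0 < α) (hα : α < Real.sqrt (5 / 4)) (hβ : β ^ 2 < 4 / 3) (ha : 0 ≤ a)
    (hS : 0 ≤ S)
    (haS : S * a * (2 * β + 1) ≤ min (1 - 3 / 4 * β ^ 2) (1 / 2) / 8)
    (hd0 : ∀ i, 0 ≤ d i) (hd1 : ∑ i, d i = 1)
    (hdα : ∀ i, b i / totalWeight b / α ≤ d i) (hdβ : ∀ i, d i ≤ β * (b i / totalWeight b))
    (hz : ∑ i, b i * z i = 0) :
    coshPotential b z + ∑ i, ∑ j, d i * d j * (a * (min (Real.sinh (z i)) (Real.sinh (z j)) -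
        ∑ m, b m / totalWeight b * Real.sinh (z m))) +
      S * ∑ i, ∑ j, d i * d j * (a ^ 2 * (Real.cosh (z i) + Real.cosh (z j) +
        coshPotential b z / totalWeight b)) ≤
    (1 - a * min (1 - 3 / 4 * β ^ 2) (1 / 2) / 8 / totalWeight b) * coshPotential b z +
      a * min (1 - 3 / 4 * β ^ 2) (1 / 2) / 4 := by
  obtain ⟨i₀⟩ : Nonempty (Fin n) := by
    by_contra h
    rw [not_nonempty_iff] at h
    simp at hd1
  set δ := min (1 - 3 / 4 * β ^ 2) (1 / 2) with hδ
  have hδ0 : 0 ≤ δ := le_min (by linarith) (by norm_num)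
  set N : ℝ := (totalWeight b : ℝ) with hN
  have hN0 : 0 < N := (Nat.cast_pos.2 (hb i₀)).trans_le (le_totalWeight i₀)
  set q : Fin n → ℝ := fun i => b i / N with hq
  have hq0 : ∀ i, 0 ≤ q i := fun i => by positivity
  have hq1 : ∑ i, q i = 1 := by
    simp only [hq]
    rw [← Finset.sum_div, ← cast_totalWeight, ← hN, div_self hN0.ne']
  have hqz : ∑ i, q i * z i = 0 := by
    simp only [hq, div_mul_eq_mul_div]
    rw [← Finset.sum_div, hz, zero_div]
  have hA : ∀ A : Finset (Fin n), δ * ((∑ i ∈ A, q i) * (1 - ∑ i ∈ A, q i)) ≤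
      ∑ i ∈ A, q i - (∑ i ∈ A, d i) ^ 2 := by
    intro A
    have hqc := Finset.sum_add_sum_compl A q
    have hdc := Finset.sum_add_sum_compl A d
    have hqc0 : 0 ≤ ∑ i ∈ Aᶜ, q i := Finset.sum_nonneg fun i _ => hq0 i
    refine sq_le_sub_of_biased hα_pos hα hβ (Finset.sum_nonneg fun i _ => hq0 i) (by linarith)
      (Finset.sum_nonneg fun i _ => hd0 i) ?_ ?_
    · rw [Finset.mul_sum]
      exact Finset.sum_le_sum fun i _ => hdβ i
    · rw [show 1 - ∑ i ∈ A, q i = ∑ i ∈ Aᶜ, q i by linarith,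
        show 1 - ∑ i ∈ A, d i = ∑ i ∈ Aᶜ, d i by linarith, Finset.sum_div]
      exact Finset.sum_le_sum fun i _ => hdα i
  have main := sinh_min_drift hδ0 hq0 hq1 hd1 hqz hA
  set G := coshPotential b z with hG
  have hG0 : 0 ≤ G := coshPotential_nonneg z
  have hqG : ∑ i, q i * Real.cosh (z i) = G / N := by
    simp only [hq, div_mul_eq_mul_div]
    rw [← Finset.sum_div]; rfl
  have hdG : ∑ i, d i * Real.cosh (z i) ≤ β * (G / N) := by
    rw [← hqG, Finset.mul_sum]
    refine Finset.sum_le_sum fun i _ => ?_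
    rw [← mul_assoc]
    exact mul_le_mul_of_nonneg_right (hdβ i) (Real.cosh_pos _).le
  have e1 : ∑ i, ∑ j, d i * d j * (a * (min (Real.sinh (z i)) (Real.sinh (z j)) -
        ∑ m, q m * Real.sinh (z m))) =
      a * (∑ i, ∑ j, d i * d j * min (Real.sinh (z i)) (Real.sinh (z j)) -
        ∑ m, q m * Real.sinh (z m)) := by
    simp_rw [mul_left_comm _ a, ← Finset.mul_sum, mul_sub, Finset.sum_sub_distrib,
      ← Finset.sum_mul, ← Finset.mul_sum, hd1]
    simp only [mul_one, hd1]
    ring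
  have e2 : ∑ i, ∑ j, d i * d j * (a ^ 2 * (Real.cosh (z i) + Real.cosh (z j) + G / N)) =
      a ^ 2 * (2 * ∑ i, d i * Real.cosh (z i) + G / N) := by
    have : ∀ i j, d i * d j * (a ^ 2 * (Real.cosh (z i) + Real.cosh (z j) + G / N)) =
        a ^ 2 * (d i * Real.cosh (z i) * d j + d i * (d j * Real.cosh (z j)) +
          d i * d j * (G / N)) := fun i j => by ring
    simp_rw [this, ← Finset.mul_sum, Finset.sum_add_distrib, ← Finset.mul_sum, ← Finset.sum_mul,
      ← Finset.mul_sum, hd1]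
    simp only [mul_one, hd1]
    ring
  rw [e1, e2]
  rw [hqG] at main
  have h1 := mul_le_mul_of_nonneg_left main ha
  have hGN : 0 ≤ G / N := by positivity
  have h2 : S * (a ^ 2 * (2 * ∑ i, d i * Real.cosh (z i) + G / N)) ≤ a * (δ / 8) * (G / N) := by
    calc _ ≤ S * (a ^ 2 * (2 * (β * (G / N)) + G / N)) := by gcongr
      _ = a * (S * a * (2 * β + 1)) * (G / N) := by ring
      _ ≤ _ := by gcongr
  have e3 : (1 - a * δ / 8 / N) * G = G - a * (δ / 8) * (G / N) := by ring
  rw [e3]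
  nlinarith

end Deterministic

/-! ### Gap versus potential, and moments of the weights -/

/-- Either the fullest bin is at least `g / 2` above the average or the emptiest is at least `g / 2`
below it. -/
theorem exp_le_coshPotential_of_le_binGap {Ω : Type*} {n : ℕ} [Nonempty (Fin n)]
    {b : Fin n → ℕ} (hb : ∀ i, 0 < b i) {a : ℝ} (ha : 0 < a) {c : ℕ → Ω → Fin n}
    {w : ℕ → Ω → ℝ} {t : ℕ} {ω : Ω} {g : ℝ} (hg : g ≤ binGap b c w t ω) :
    Real.exp (a * g / 2) / 2 ≤ coshPotential b fun i => binDeviation a b c w t i ω := by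
  obtain ⟨i, hi⟩ := exists_eq_ciSup_of_finite (f := fun i => binValue b c w t i ω)
  obtain ⟨j, hj⟩ := exists_eq_ciInf_of_finite (f := fun i => binValue b c w t i ω)
  rw [binGap, ← hi, ← hj] at hg
  have h : a * g ≤ binDeviation a b c w t i ω - binDeviation a b c w t j ω := by
    rw [binDeviation, binDeviation, ← mul_sub]
    exact mul_le_mul_of_nonneg_left (by linarith) ha.le
  have hi' := cosh_le_coshPotential hb (fun i => binDeviation a b c w t i ω) i
  have hj' := cosh_le_coshPotential hb (fun i => binDeviation a b c w t i ω) j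
  rcases le_total (a * g / 2) (binDeviation a b c w t i ω) with h1 | h1
  · refine le_trans ?_ hi'
    rw [Real.cosh_eq]
    have := Real.exp_le_exp.2 h1
    have := Real.exp_pos (-binDeviation a b c w t i ω)
    linarith
  · refine le_trans ?_ hj'
    rw [Real.cosh_eq]
    have := Real.exp_le_exp.2 (show a * g / 2 ≤ -binDeviation a b c w t j ω by linarith)
    have := Real.exp_pos (binDeviation a b c w t j ω)
    linarith

/-- Half of the exponential rate is given up to absorb the factor `z ^ 2`. -/
theorem integrable_sq_mul_exp {W : Measure ℝ} (hW_nonneg : ∀ᵐ z ∂W, 0 ≤ z) {l : ℝ} (hl : 0 < l)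
    (hW : Integrable (fun z => Real.exp (l * z)) W) :
    Integrable (fun z => z ^ 2 * Real.exp (l / 2 * |z|)) W := by
  refine (hW.const_mul (8 / l ^ 2)).mono' (by fun_prop) ?_
  filter_upwards [hW_nonneg] with z hz
  rw [Real.norm_of_nonneg (by positivity), abs_of_nonneg hz]
  have h := Real.pow_div_factorial_le_exp (l / 2 * z) (by positivity) 2
  have e : Real.exp (l * z) = Real.exp (l / 2 * z) * Real.exp (l / 2 * z) := by
    rw [← Real.exp_add]; ring_nf
  rw [e, ← mul_assoc]
  refine mul_le_mul_of_nonneg_right ?_ (Real.exp_pos _).le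
  calc z ^ 2 = 8 / l ^ 2 * ((l / 2 * z) ^ 2 / (Nat.factorial 2 : ℕ)) := by
        simp only [Nat.factorial]; push_cast; field_simp; norm_num
    _ ≤ _ := by gcongr

/-! ### One random round in expectation -/

/-- The deviations before round `s + 1` are a function of the earlier draws and choices. -/
theorem exists_binDeviation_eq {Ω : Type*} {n : ℕ} (a : ℝ) (b : Fin n → ℕ) (x y c : ℕ → Ω → Fin n)
    (w : ℕ → Ω → ℝ) (s : ℕ) :
    ∃ φ : (Fin s → Fin n × Fin n × ℝ × Fin n) → Fin n → ℝ, Measurable φ ∧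
      ∀ ω, (fun i => binDeviation a b c w s i ω) =
        φ fun r : Fin s => (x r ω, y r ω, w r ω, c r ω) := by
  refine ⟨fun h i => a * ((∑ r : Fin s, if (h r).2.2.2 = i then (h r).2.2.1 else 0) / b i -
    (∑ r : Fin s, (h r).2.2.1) / totalWeight b), ?_, ?_⟩
  · refine measurable_pi_lambda _ fun i => ?_
    have hm : ∀ r : Fin s, Measurable fun h : Fin s → Fin n × Fin n × ℝ × Fin n =>
        if (h r).2.2.2 = i then (h r).2.2.1 else 0 := fun r =>
      Measurable.ite ((measurableSet_singleton i).preimage (by fun_prop)) (by fun_prop)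
        measurable_const
    have h1 := Finset.measurable_sum Finset.univ fun r _ => hm r
    have h2 : Measurable fun h : Fin s → Fin n × Fin n × ℝ × Fin n =>
        ∑ r : Fin s, (h r).2.2.1 := Finset.measurable_sum _ fun r _ => by fun_prop
    exact ((h1.div_const _).sub (h2.div_const _)).const_mul a
  · intro ω
    funext i
    simp only [binDeviation, binValue, binLoad, Finset.sum_range]

theorem integral_sum_sum {Ω ι : Type*} [MeasurableSpace Ω] [Fintype ι] {μ : Measure Ω}
    {F : ι → ι → Ω → ℝ} (hF : ∀ i j, Integrable (F i j) μ) :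
    ∫ ω, ∑ i, ∑ j, F i j ω ∂μ = ∑ i, ∑ j, ∫ ω, F i j ω ∂μ := by
  rw [integral_finsetSum _ fun i _ => integrable_finsetSum _ fun j _ => hF i j]
  exact Finset.sum_congr rfl fun i _ => integral_finsetSum _ fun j _ => hF i j

namespace IsTwoChoiceProcess

variable {Ω : Type*} [MeasurableSpace Ω] {μ : Measure Ω} {n : ℕ} {b : Fin n → ℕ}
  {D : Measure (Fin n)} {W : Measure ℝ} {x y c : ℕ → Ω → Fin n} {w : ℕ → Ω → ℝ}

theorem integrable_draw [IsProbabilityMeasure D] [SFinite W]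
    (p : IsTwoChoiceProcess μ b D W x y c w) (s : ℕ)
    (i j : Fin n) {f : ℝ → ℝ} (hf : Integrable f W) :
    Integrable (fun ω => (if x s ω = i then (1 : ℝ) else 0) *
      ((if y s ω = j then (1 : ℝ) else 0) * f (w s ω))) μ := by
  have hi : ∀ i : Fin n, Integrable (fun k => if k = i then (1 : ℝ) else 0) D :=
    fun i => Integrable.of_finite
  have h := (hi i).mul_prod ((hi j).mul_prod hf)
  rw [← p.law s] at h
  exact h.comp_measurable
    ((p.measurable_x s).prodMk ((p.measurable_y s).prodMk (p.measurable_w s)))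

theorem integral_draw [IsProbabilityMeasure D] [SFinite W]
    (p : IsTwoChoiceProcess μ b D W x y c w) (s : ℕ)
    (i j : Fin n) {f : ℝ → ℝ} (hf : Integrable f W) :
    ∫ ω, (if x s ω = i then (1 : ℝ) else 0) *
      ((if y s ω = j then (1 : ℝ) else 0) * f (w s ω)) ∂μ =
      D.real {i} * D.real {j} * ∫ z, f z ∂W := by
  have hi : ∀ i : Fin n, Integrable (fun k => if k = i then (1 : ℝ) else 0) D :=
    fun i => Integrable.of_finite
  have hi' : ∀ i : Fin n, ∫ k, (if k = i then (1 : ℝ) else 0) ∂D = D.real {i} := by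
    intro i
    rw [← integral_indicator_one (MeasurableSet.singleton i)]
    refine integral_congr_ae (.of_forall fun k => ?_)
    simp [Set.indicator_apply]
  have h := (hi i).mul_prod ((hi j).mul_prod hf)
  have hX := (p.measurable_x s).prodMk ((p.measurable_y s).prodMk (p.measurable_w s))
  have h1 := integral_map (μ := μ) hX.aemeasurable
    (f := fun r : Fin n × Fin n × ℝ => (if r.1 = i then (1 : ℝ) else 0) *
      ((if r.2.1 = j then (1 : ℝ) else 0) * f r.2.2)) (by
      rw [p.law s]; exact h.aestronglyMeasurable)
  rw [← h1, p.law s,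
    integral_prod_mul (μ := D) (ν := D.prod W) (fun k => if k = i then (1 : ℝ) else 0)
      (fun r : Fin n × ℝ => (if r.1 = j then (1 : ℝ) else 0) * f r.2),
    integral_prod_mul (μ := D) (ν := W) (fun k => if k = j then (1 : ℝ) else 0) f, hi', hi',
    mul_assoc]

theorem measurable_binDeviation (p : IsTwoChoiceProcess μ b D W x y c w) (a : ℝ) (s : ℕ) :
    Measurable fun ω i => binDeviation a b c w s i ω := by
  obtain ⟨φ, hφ, h⟩ := exists_binDeviation_eq a b x y c w s
  rw [show (fun ω i => binDeviation a b c w s i ω) = _ from funext h]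
  refine hφ.comp (measurable_pi_lambda _ fun r => ?_)
  exact (p.measurable_x r).prodMk ((p.measurable_y r).prodMk
    ((p.measurable_w r).prodMk (p.measurable_c r)))

/-- This replaces conditioning on the past: the expectation of a draw term times a function of the
deviations factors. -/
theorem indepFun_draw_binDeviation (p : IsTwoChoiceProcess μ b D W x y c w) (a : ℝ) (s : ℕ)
    (i j : Fin n) {f : ℝ → ℝ} (hf : Measurable f) {g : (Fin n → ℝ) → ℝ} (hg : Measurable g) :
    IndepFun (fun ω => (if x s ω = i then (1 : ℝ) else 0) *
      ((if y s ω = j then (1 : ℝ) else 0) * f (w s ω)))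
      (fun ω => g fun m => binDeviation a b c w s m ω) μ := by
  obtain ⟨φ, hφ, h⟩ := exists_binDeviation_eq a b x y c w s
  simp_rw [h]
  refine (p.indep s).comp (φ := fun r : Fin n × Fin n × ℝ => (if r.1 = i then (1 : ℝ) else 0) *
      ((if r.2.1 = j then (1 : ℝ) else 0) * f r.2.2)) ?_ (hg.comp hφ)
  refine Measurable.mul ?_ (Measurable.mul ?_ (by fun_prop))
  · exact Measurable.ite ((measurableSet_singleton i).preimage (by fun_prop)) measurable_const
      measurable_const
  · exact Measurable.ite ((measurableSet_singleton j).preimage (by fun_prop)) measurable_const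
      measurable_const

/-- Tied bins have equal deviations, so the tie-breaking rule drops out. -/
theorem sinh_binDeviation_choice (p : IsTwoChoiceProcess μ b D W x y c w) {a : ℝ} (ha : 0 ≤ a)
    (s : ℕ) (ω : Ω) :
    Real.sinh (binDeviation a b c w s (c s ω) ω) =
      min (Real.sinh (binDeviation a b c w s (x s ω) ω))
        (Real.sinh (binDeviation a b c w s (y s ω) ω)) := by
  have hmono : ∀ i j, binValue b c w s i ω ≤ binValue b c w s j ω →
      Real.sinh (binDeviation a b c w s i ω) ≤ Real.sinh (binDeviation a b c w s j ω) :=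
    fun i j h => Real.sinh_le_sinh.2
      (mul_le_mul_of_nonneg_left (sub_le_sub_right h _) ha)
  have h1 := hmono _ _ (p.choice_le s ω).1
  have h2 := hmono _ _ (p.choice_le s ω).2
  rcases p.choice_mem s ω with h | h
  · rw [h] at h2 ⊢; exact (min_eq_left h2).symm
  · rw [h] at h1 ⊢; exact (min_eq_right h1).symm

/-- Each summand is a function of the fresh draws times a function of the past. Bounding the `cosh`
of the chosen bin by the sum over both drawn bins removes `c` from the error term. -/
theorem coshPotential_succ_le (p : IsTwoChoiceProcess μ b D W x y c w) (hb : ∀ i, 0 < b i)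
    {a l : ℝ} (ha : 0 ≤ a) (hal : a ≤ l) (s : ℕ) (ω : Ω) :
    coshPotential b (fun i => binDeviation a b c w (s + 1) i ω) ≤
      coshPotential b (fun i => binDeviation a b c w s i ω) +
      ∑ i, ∑ j, ((if x s ω = i then (1 : ℝ) else 0) *
        ((if y s ω = j then (1 : ℝ) else 0) * w s ω)) *
        (a * (min (Real.sinh (binDeviation a b c w s i ω))
          (Real.sinh (binDeviation a b c w s j ω)) -
          ∑ m, b m / totalWeight b * Real.sinh (binDeviation a b c w s m ω))) +
      ∑ i, ∑ j, ((if x s ω = i then (1 : ℝ) else 0) *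
        ((if y s ω = j then (1 : ℝ) else 0) * (w s ω ^ 2 * Real.exp (l * |w s ω|)))) *
        (a ^ 2 * (Real.cosh (binDeviation a b c w s i ω) +
          Real.cosh (binDeviation a b c w s j ω) +
          coshPotential b (fun i => binDeviation a b c w s i ω) / totalWeight b)) := by
  have pick : ∀ (v : ℝ) (f : Fin n → Fin n → ℝ),
      ∑ i, ∑ j, ((if x s ω = i then (1 : ℝ) else 0) *
        ((if y s ω = j then (1 : ℝ) else 0) * v)) * f i j = v * f (x s ω) (y s ω) := by
    intro v f
    simp_rw [mul_assoc, ← Finset.mul_sum, ite_mul, one_mul, zero_mul, Finset.sum_ite_eq,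
      Finset.mem_univ, if_true]
  rw [pick, pick]
  simp_rw [binDeviation_succ]
  refine (coshPotential_step hb ha hal _ _ _).trans ?_
  rw [← p.sinh_binDeviation_choice ha]
  have hcosh : Real.cosh (binDeviation a b c w s (c s ω) ω) ≤
      Real.cosh (binDeviation a b c w s (x s ω) ω) +
        Real.cosh (binDeviation a b c w s (y s ω) ω) := by
    have h1 := (Real.cosh_pos (binDeviation a b c w s (x s ω) ω)).le
    have h2 := (Real.cosh_pos (binDeviation a b c w s (y s ω) ω)).le
    rcases p.choice_mem s ω with h | h <;> rw [h] <;> linarith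
  gcongr

theorem integral_coshPotential_le [IsProbabilityMeasure μ] [IsProbabilityMeasure D]
    [IsProbabilityMeasure W] (p : IsTwoChoiceProcess μ b D W x y c w) (hb : ∀ i, 0 < b i)
    (hW_mean : ∫ z, z ∂W = 1) {α β a l : ℝ}
    (hW : Integrable (fun z => z ^ 2 * Real.exp (l * |z|)) W)
    (hα_pos : 0 < α) (hα : α < Real.sqrt (5 / 4)) (hβ : β ^ 2 < 4 / 3) (ha : 0 ≤ a)
    (ha1 : a ≤ 1) (hal : a ≤ l)
    (haS : (∫ z, z ^ 2 * Real.exp (l * |z|) ∂W) * a * (2 * β + 1) ≤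
      min (1 - 3 / 4 * β ^ 2) (1 / 2) / 8)
    (hdα : ∀ i, b i / totalWeight b / α ≤ D.real {i})
    (hdβ : ∀ i, D.real {i} ≤ β * (b i / totalWeight b)) (t : ℕ) :
    Integrable (fun ω => coshPotential b fun i => binDeviation a b c w t i ω) μ ∧
      ∫ ω, coshPotential b (fun i => binDeviation a b c w t i ω) ∂μ ≤ 2 * totalWeight b := by
  have hd1 : ∑ i, D.real {i} = 1 := by
    rw [sum_measureReal_singleton]; simp
  -- The integral of a non-integrable function is 0 by convention, so mean 1 forces integrability.
  have hWi : Integrable (fun z => z) W := by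
    by_contra h
    rw [integral_undef h] at hW_mean
    exact zero_ne_one hW_mean
  obtain ⟨i₀⟩ : Nonempty (Fin n) := by
    by_contra h
    rw [not_nonempty_iff] at h
    simp at hd1
  set δ := min (1 - 3 / 4 * β ^ 2) (1 / 2) with hδ
  have hδ0 : 0 ≤ δ := le_min (by linarith) (by norm_num)
  have hδ1 : δ ≤ 1 / 2 := min_le_right _ _
  have hN1 : (1 : ℝ) ≤ totalWeight b :=
    (show (1 : ℝ) ≤ b i₀ by exact_mod_cast hb i₀).trans (le_totalWeight i₀)
  have hGm : Measurable fun z : Fin n → ℝ => coshPotential b z :=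
    Finset.measurable_sum _ fun i _ => by fun_prop
  induction t with
  | zero =>
    simp only [binDeviation_zero, coshPotential, Real.cosh_zero, mul_one, ← cast_totalWeight]
    refine ⟨integrable_const _, ?_⟩
    simp only [integral_const, probReal_univ, smul_eq_mul, one_mul]
    linarith
  | succ t ih =>
    obtain ⟨hGi, hG⟩ := ih
    set z : Fin n → Ω → ℝ := fun i ω => binDeviation a b c w t i ω with hz
    have hzm : ∀ i, Measurable (z i) := fun i =>
      (measurable_pi_apply i).comp (p.measurable_binDeviation a t)
    have hcosh : ∀ i, Integrable (fun ω => Real.cosh (z i ω)) μ := fun i =>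
      hGi.mono' (Real.measurable_cosh.comp (hzm i)).aestronglyMeasurable (.of_forall fun ω => by
        rw [Real.norm_of_nonneg (Real.cosh_pos _).le]
        exact cosh_le_coshPotential hb (fun i => z i ω) i)
    have hsinh : ∀ i, Integrable (fun ω => Real.sinh (z i ω)) μ := fun i =>
      (hcosh i).mono' (Real.measurable_sinh.comp (hzm i)).aestronglyMeasurable
        (.of_forall fun ω => by
          rw [Real.norm_eq_abs, abs_le, Real.sinh_eq, Real.cosh_eq]
          have := Real.exp_pos (z i ω)
          have := Real.exp_pos (-z i ω)
          constructor <;> linarith)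
    set A : Fin n → Fin n → (Fin n → ℝ) → ℝ := fun i j z =>
      a * (min (Real.sinh (z i)) (Real.sinh (z j)) -
        ∑ m, b m / totalWeight b * Real.sinh (z m)) with hA
    set B : Fin n → Fin n → (Fin n → ℝ) → ℝ := fun i j z =>
      a ^ 2 * (Real.cosh (z i) + Real.cosh (z j) + coshPotential b z / totalWeight b) with hB
    have hAm : ∀ i j, Measurable (A i j) := fun i j => by
      have : Measurable fun z : Fin n → ℝ => ∑ m, b m / totalWeight b * Real.sinh (z m) :=
        Finset.measurable_sum _ fun i _ => by fun_prop
      simp only [hA]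
      fun_prop
    have hBm : ∀ i j, Measurable (B i j) := fun i j => by
      simp only [hB]
      fun_prop
    have hAi : ∀ i j, Integrable (fun ω => A i j fun m => z m ω) μ := fun i j =>
      (((hsinh i).inf (hsinh j)).sub
        (integrable_finsetSum _ fun m _ => (hsinh m).const_mul _)).const_mul a
    have hBi : ∀ i j, Integrable (fun ω => B i j fun m => z m ω) μ := fun i j =>
      (((hcosh i).add (hcosh j)).add (hGi.div_const _)).const_mul _
    have hf : Measurable fun z : ℝ => z ^ 2 * Real.exp (l * |z|) := by fun_prop
    have hUAi := fun i j => (p.indepFun_draw_binDeviation a t i j measurable_id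
      (hAm i j)).integrable_mul (p.integrable_draw t i j hWi) (hAi i j)
    have hVBi := fun i j => (p.indepFun_draw_binDeviation a t i j hf
      (hBm i j)).integrable_mul (p.integrable_draw t i j hW) (hBi i j)
    have hUA := fun i j => (p.indepFun_draw_binDeviation a t i j measurable_id
      (hAm i j)).integral_fun_mul_eq_mul_integral (p.integrable_draw t i j hWi).1 (hAi i j).1
    have hVB := fun i j => (p.indepFun_draw_binDeviation a t i j hf
      (hBm i j)).integral_fun_mul_eq_mul_integral (p.integrable_draw t i j hW).1 (hBi i j).1
    simp only [id_eq, p.integral_draw t _ _ hWi, hW_mean, mul_one] at hUA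
    simp only [p.integral_draw t _ _ hW] at hVB
    set S := ∫ z, z ^ 2 * Real.exp (l * |z|) ∂W with hS
    have hS0 : 0 ≤ S := integral_nonneg fun z => by positivity
    have hsA := integrable_finsetSum Finset.univ fun i _ =>
      integrable_finsetSum Finset.univ fun j _ => hUAi i j
    have hsB := integrable_finsetSum Finset.univ fun i _ =>
      integrable_finsetSum Finset.univ fun j _ => hVBi i j
    have hDA := fun i j => (hAi i j).const_mul (D.real {i} * D.real {j})
    have hDB := fun i j => (hBi i j).const_mul (D.real {i} * D.real {j})
    have hsDA := integrable_finsetSum Finset.univ fun i _ =>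
      integrable_finsetSum Finset.univ fun j _ => hDA i j
    have hsDB := (integrable_finsetSum Finset.univ fun i _ =>
      integrable_finsetSum Finset.univ fun j _ => hDB i j).const_mul S
    have hstep := fun ω => p.coshPotential_succ_le hb ha hal t ω
    have hint : Integrable
        (fun ω => coshPotential b fun i => binDeviation a b c w (t + 1) i ω) μ :=
      ((hGi.add hsA).add hsB).mono'
        (hGm.comp (p.measurable_binDeviation a (t + 1))).aestronglyMeasurable
        (.of_forall fun ω => by
          rw [Real.norm_of_nonneg (coshPotential_nonneg _)]
          exact hstep ω)
    refine ⟨hint, ?_⟩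
    have hle := integral_mono hint ((hGi.add hsA).add hsB) hstep
    have hdrift := integral_mono ((hGi.add hsDA).add hsDB)
      ((hGi.const_mul (1 - a * δ / 8 / totalWeight b)).add (integrable_const (a * δ / 4)))
      (fun ω => coshPotential_drift (z := fun i => z i ω) hb hα_pos hα hβ ha hS0 haS
        (fun i => measureReal_nonneg) hd1 hdα hdβ (sum_mul_binDeviation hb a c w t ω))
    rw [integral_add' (hGi.add hsA) hsB, integral_add' hGi hsA] at hle
    erw [integral_sum_sum hUAi, integral_sum_sum hVBi] at hle
    simp only [Pi.mul_apply, id_eq, hUA, hVB] at hle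
    rw [integral_add' (hGi.add hsDA) hsDB, integral_add' hGi hsDA,
      integral_add' (hGi.const_mul _) (integrable_const _), integral_const_mul,
      integral_const_mul, integral_sum_sum hDA, integral_sum_sum hDB] at hdrift
    simp only [integral_const_mul, integral_const, probReal_univ, smul_eq_mul, one_mul] at hdrift
    have hx : 0 ≤ 1 - a * δ / 8 / totalWeight b := by
      rw [sub_nonneg, div_le_one (by linarith)]
      nlinarith
    -- `2N` is the fixed point of the affine recursion, so the bound reproduces itself.
    have hfin : (1 - a * δ / 8 / totalWeight b) *
        ∫ ω, coshPotential b (fun i => z i ω) ∂μ + a * δ / 4 ≤ 2 * totalWeight b := by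
      have hN0 : (totalWeight b : ℝ) ≠ 0 := by linarith
      calc _ ≤ (1 - a * δ / 8 / totalWeight b) * (2 * totalWeight b) + a * δ / 4 := by gcongr
        _ = _ := by field_simp; ring
    refine hle.trans (le_trans (le_of_eq ?_) (hdrift.trans hfin))
    congr 1
    rw [Finset.mul_sum]
    simp_rw [Finset.mul_sum]
    refine Finset.sum_congr rfl fun i _ => Finset.sum_congr rfl fun j _ => ?_
    ring

end IsTwoChoiceProcess

/-! ### Choice of constants and Markov's inequality -/

theorem mainTheorem2 (α β : ℝ) (hα_pos : 0 < α) (hα : α < Real.sqrt (5 / 4))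
    (hβ : β < Real.sqrt (4 / 3))
    (W : Measure ℝ) [IsProbabilityMeasure W] (hW_nonneg : ∀ᵐ z ∂W, 0 ≤ z)
    (hW_mgf : ∃ l : ℝ, 0 < l ∧ Integrable (fun z => Real.exp (l * z)) W)
    (hW_mean : ∫ z, z ∂W = 1) :
    ∃ a c' : ℝ, 0 < a ∧ a < 1 ∧ 0 < c' ∧
      ∀ (n : ℕ) (b : Fin n → ℕ), (∀ i, 0 < b i) →
      ∀ (D : Measure (Fin n)) [IsProbabilityMeasure D], IsBiased α β b D →
      ∀ (Ω : Type*) [MeasurableSpace Ω] (μ : Measure Ω) [IsProbabilityMeasure μ]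
        (x y c : ℕ → Ω → Fin n) (w : ℕ → Ω → ℝ),
        IsTwoChoiceProcess μ b D W x y c w →
      ∀ (k : ℝ), 0 < k → ∀ t : ℕ,
        μ.real {ω | 2 * k / a * Real.log (c' / a ^ (1 / k) * totalWeight b) ≤ binGap b c w t ω}
          ≤ (totalWeight b : ℝ) ^ (-(k - 1)) := by
  obtain ⟨l, hl, hl_int⟩ := hW_mgf
  have hW2 := integrable_sq_mul_exp hW_nonneg hl hl_int
  set S := ∫ z, z ^ 2 * Real.exp (l / 2 * |z|) ∂W with hS
  have hS0 : 0 ≤ S := integral_nonneg fun z => by positivity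
  -- Nothing bounds `β` below, so truncation at 0 is needed to pass to squares.
  set β' := max β 0 with hβ'
  have hβ'0 : 0 ≤ β' := le_max_right _ _
  have hβ'2 : β' ^ 2 < 4 / 3 := by
    rw [← Real.sq_sqrt (show (0 : ℝ) ≤ 4 / 3 by norm_num)]
    exact pow_lt_pow_left₀ (max_lt hβ (by positivity)) hβ'0 two_ne_zero
  set δ := min (1 - 3 / 4 * β' ^ 2) (1 / 2) with hδ
  have hδ0 : 0 < δ := lt_min (by linarith) (by norm_num)
  -- The three bounds serve the final Markov estimate, the exponential moment and the drift; `S + 1`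
  -- keeps the denominator positive.
  set a := min (1 / 2) (min (l / 2) (δ / (8 * ((S + 1) * (2 * β' + 1))))) with ha
  have ha0 : 0 < a := lt_min (by norm_num) (lt_min (by positivity) (by positivity))
  have ha1 : a ≤ 1 / 2 := min_le_left _ _
  have hal : a ≤ l / 2 := (min_le_right _ _).trans (min_le_left _ _)
  have haδ : a ≤ δ / (8 * ((S + 1) * (2 * β' + 1))) :=
    (min_le_right _ _).trans (min_le_right _ _)
  have haS : S * a * (2 * β' + 1) ≤ δ / 8 := by
    rw [le_div_iff₀ (by positivity)] at haδ
    have : 0 ≤ a * (2 * β' + 1) := by positivity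
    linarith
  refine ⟨a, 4, ha0, by linarith, by norm_num, ?_⟩
  intro n b hb D _ hD Ω _ μ _ x y c w p k hk t
  obtain ⟨i₀⟩ : Nonempty (Fin n) := by
    by_contra h
    rw [not_nonempty_iff] at h
    exact IsProbabilityMeasure.ne_zero D (Measure.eq_zero_of_isEmpty D)
  have hN1 : (1 : ℝ) ≤ totalWeight b :=
    (show (1 : ℝ) ≤ b i₀ by exact_mod_cast hb i₀).trans (le_totalWeight i₀)
  have hN0 : (0 : ℝ) < totalWeight b := by linarith
  -- For `k ≤ 1` the right-hand side is at least 1.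
  rcases le_total k 1 with hk1 | hk1
  · exact measureReal_le_one.trans (Real.one_le_rpow hN1 (by linarith))
  have hdα : ∀ i, b i / totalWeight b / α ≤ D.real {i} := fun i => by
    rw [div_div, mul_comm]; exact (hD i).1
  have hdβ : ∀ i, D.real {i} ≤ β' * (b i / totalWeight b) := fun i => by
    refine (hD i).2.trans ?_
    rw [mul_div_assoc]
    exact mul_le_mul_of_nonneg_right (le_max_left _ _) (by positivity)
  obtain ⟨hint, hle⟩ := p.integral_coshPotential_le hb hW_mean hW2 hα_pos hα hβ'2 ha0.le
    (by linarith) hal haS hdα hdβ t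
  set g := 2 * k / a * Real.log (4 / a ^ (1 / k) * totalWeight b) with hg
  -- The power `a ^ (1 / k)` in the threshold is there to become a plain factor `a` here.
  have hexp : Real.exp (a * g / 2) = (4 * totalWeight b) ^ k / a := by
    have hak : (a ^ (1 / k)) ^ k = a := by
      rw [← Real.rpow_mul ha0.le, one_div_mul_cancel hk.ne', Real.rpow_one]
    have h1 : a * g / 2 = Real.log (4 / a ^ (1 / k) * totalWeight b) * k := by
      rw [hg]; field_simp
    rw [h1, ← Real.rpow_def_of_pos (by positivity), div_mul_eq_mul_div,
      Real.div_rpow (by positivity) (by positivity), hak]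
  have hsub : {ω | g ≤ binGap b c w t ω} ⊆
      {ω | (4 * totalWeight b) ^ k / a / 2 ≤
        coshPotential b fun i => binDeviation a b c w t i ω} := by
    intro ω hω
    have : Nonempty (Fin n) := ⟨i₀⟩
    have := exp_le_coshPotential_of_le_binGap hb ha0 (show g ≤ binGap b c w t ω from hω)
    rwa [hexp] at this
  have hmarkov := mul_meas_ge_le_integral_of_nonneg
    (.of_forall fun ω => coshPotential_nonneg (b := b) fun i => binDeviation a b c w t i ω) hint
    ((4 * totalWeight b) ^ k / a / 2)
  refine (measureReal_mono hsub).trans ?_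
  have hpos : (0 : ℝ) < (4 * totalWeight b) ^ k / a / 2 := by positivity
  have h2 := (le_div_iff₀' hpos).2 (hmarkov.trans hle)
  refine h2.trans ?_
  have h4 : (4 : ℝ) ≤ 4 ^ k := by
    simpa using Real.rpow_le_rpow_of_exponent_le (show (1 : ℝ) ≤ 4 by norm_num) hk1
  have hNk : (0 : ℝ) < (totalWeight b : ℝ) ^ k := by positivity
  rw [neg_sub, Real.rpow_sub hN0, Real.rpow_one, Real.mul_rpow (by norm_num) hN0.le,
    div_le_div_iff₀ (by positivity) hNk]
  have h5 : 4 ^ k * (totalWeight b : ℝ) ^ k / a / 2 ≥ 4 * (totalWeight b : ℝ) ^ k := by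
    rw [ge_iff_le, le_div_iff₀ (by norm_num), le_div_iff₀ ha0]
    calc 4 * (totalWeight b : ℝ) ^ k * 2 * a ≤ 4 * (totalWeight b : ℝ) ^ k * 2 * (1 / 2) := by
          gcongr
      _ = 4 * (totalWeight b : ℝ) ^ k := by ring
      _ ≤ _ := by gcongr
  calc 2 * (totalWeight b : ℝ) * (totalWeight b : ℝ) ^ k
      ≤ (totalWeight b : ℝ) * (4 * (totalWeight b : ℝ) ^ k) := by nlinarith [mul_pos hN0 hNk]
    _ ≤ _ := by gcongr
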